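/- Let $\mathcal{X}$ be an arithmetic variety over $\mathrm{Spec}(\mathbb{Z})$, that is, a projective, integral and flat scheme over $\mathbb{Z}$ whose generic fibre $\mathcal{X}_{\mathbb{Q}}$ is smooth over $\mathbb{Q}$, and let $\mathcal{L}$ be a line bundle on $\mathcal{X}$. Let $X=\mathcal{X}(\mathbb{C})$ with its analytic topology, let $L=\mathcal{L}(\mathbb{C})$ be the induced holomorphic line bundle on $X$, let $\|\cdot\|_\phi$ be a continuous hermitian metric on $L$, and let $\mu$ be a Borel probability measure on $X$. For $s\in H^0(X,L)$ put $$\|s\|_{(\mu,\phi)}^2=\int_X\|s(x)\|_\phi^2\,d\mu(x).$$ Assume that $\|\cdot\|_{(\mu,\phi)}$ is invariant under complex conjugation on $H^0(\mathcal{X},\mathcal{L})\otimes_{\mathbb{Z}}\mathbb{C}$ (this holds if the metric and $\mu$ are invariant under the complex conjugation of $X$). For $x\in X$ let $$\rho(\mu,\phi)(x)=\sup_{s\in H^0(X,L)\setminus\{0\}}\frac{\|s(x)\|_\phi^2}{\|s\|_{(\mu,\phi)}^2}$$ be the Bergman distortion function and let $$\Theta(\mu,\phi)(x)=2\pi\sum_{v\in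 H^0(\mathcal{X},\mathcal{L})}\|v(x)\|_\phi^2\,\frac{e^{-\pi\|v\|_{(\mu,\phi)}^2}}{\sum_{u\in H^0(\mathcal{X},\mathcal{L})}e^{-\pi\|u\|_{(\mu,\phi)}^2}}$$ be the theta invariant. (Both are regarded as elements of $[0,\infty]$, and the supremum over the empty set is $0$. If $\|\cdot\|_{(\mu,\phi)}$ is a norm on $H^0(X,L)$, for instance if the support of $\mu$ is non-pluripolar in every connected component of $X$, then all denominators lie in $(0,\infty)$. Otherwise the conventions $a/0=\infty$ for $a>0$, $0/0=0$ and $a/\infty=0$ for $a<\infty$ are used.) Then $$\Theta(\mu,\phi)(x)\le\rho(\mu,\phi)(x)\qquad\text{for all }x\in X.$$ -/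

import Mathlib

open CategoryTheory AlgebraicGeometry TopologicalSpace MeasureTheory
open scoped Topology ENNReal TensorProduct

noncomputable section

namespace ArithTheta

/-- An arithmetic variety over `Spec ℤ`: an integral scheme that is projective and flat over `ℤ`
and whose generic fibre is smooth over `ℚ`. -/
structure IsArithmeticVariety {𝒳 : Scheme.{0}} (π : 𝒳 ⟶ Spec (CommRingCat.of ℤ)) : Prop where
  isIntegral : IsIntegral 𝒳
  /-- Every scheme has exactly one morphism to `Spec ℤ`, so that `i` is a morphism over `ℤ`. -/
  projective :
    letI (m : ℕ) := MvPolynomial.gradedAlgebra (σ := Fin (m + 1)) (R := ℤ)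
    ∃ (m : ℕ) (i : 𝒳 ⟶ Proj (MvPolynomial.homogeneousSubmodule (Fin (m + 1)) ℤ)),
      IsClosedImmersion i
  flat : Flat π
  smooth_generic_fibre :
    Smooth (Limits.pullback.snd π (Spec.map (CommRingCat.ofHom (algebraMap ℤ ℚ))))

section Frames

variable {𝒳 : Scheme.{0}}

/-- `e` is a frame of `ℒ` over `U`: multiplication by `e` is an isomorphism from `𝒪` to `ℒ`
over `U`. -/
def IsFrame (ℒ : 𝒳.Modules) (U : 𝒳.Opens) (e : Γ(ℒ, U)) : Prop :=
  ∀ (V : 𝒳.Opens) (h : V ≤ U),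
    Function.Bijective fun f : Γ(𝒳, V) => f • ℒ.presheaf.map (homOfLE h).op e

/-- A line bundle on `𝒳`: a sheaf of modules which is locally free of rank one. -/
def IsLineBundle (ℒ : 𝒳.Modules) : Prop :=
  ∀ p : 𝒳, ∃ (U : 𝒳.Opens) (_ : p ∈ U) (e : Γ(ℒ, U)), IsFrame ℒ U e

end Frames

/-- The set `𝒳(ℂ)` of complex points of `𝒳`. -/
def ComplexPoints (𝒳 : Scheme.{0}) : Type := Spec (CommRingCat.of ℂ) ⟶ 𝒳

namespace ComplexPoints

variable {𝒳 : Scheme.{0}}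

/-- The point of the scheme `𝒳` that underlies a complex point. -/
def pt (x : ComplexPoints 𝒳) : 𝒳 :=
  let f : Spec (CommRingCat.of ℂ) ⟶ 𝒳 := x
  f (IsLocalRing.closedPoint ℂ)

/-- The evaluation at a complex point, on germs of regular functions. -/
def evalGerm (x : ComplexPoints 𝒳) : 𝒳.presheaf.stalk x.pt →+* ℂ :=
  (Scheme.stalkClosedPointTo (R := CommRingCat.of ℂ) (X := 𝒳) x).hom

/-- The value at the complex point `x` of a regular function `f` on a neighbourhood `U` of `x`. -/
def eval (x : ComplexPoints 𝒳) {U : 𝒳.Opens} (hx : x.pt ∈ U) (f : Γ(𝒳, U)) : ℂ :=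
  x.evalGerm (𝒳.presheaf.germ U x.pt hx f)

/-- The analytic topology on `𝒳(ℂ)`: the coarsest topology in which `U(ℂ)` is open for every
Zariski open set `U` and every regular function on `U` is continuous on `U(ℂ)`. -/
instance : TopologicalSpace (ComplexPoints 𝒳) :=
  generateFrom {S | ∃ (U : 𝒳.Opens) (f : Γ(𝒳, U)) (W : Set ℂ), IsOpen W ∧
    S = {x | ∃ hx : x.pt ∈ U, x.eval hx f ∈ W}}

instance : MeasurableSpace (ComplexPoints 𝒳) := borel _

instance : BorelSpace (ComplexPoints 𝒳) := ⟨rfl⟩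

/-- A complex function on `𝒳(ℂ)` is holomorphic at `x` if, near `x`, it is a convergent power
series in finitely many regular functions. (Where `𝒳(ℂ)` is a complex manifold, the regular
functions on an affine neighbourhood embed it locally into some `ℂ^m`, and the holomorphic
functions are locally the restrictions of the holomorphic functions on `ℂ^m`.) -/
def HolomorphicAt (f : ComplexPoints 𝒳 → ℂ) (x : ComplexPoints 𝒳) : Prop :=
  ∃ (U : 𝒳.Opens) (hx : x.pt ∈ U) (m : ℕ) (h : Fin m → Γ(𝒳, U)) (G : (Fin m → ℂ) → ℂ),
    AnalyticAt ℂ G (fun i => x.eval hx (h i)) ∧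
      ∀ᶠ y in 𝓝 x, ∃ hy : y.pt ∈ U, f y = G fun i => y.eval hy (h i)

end ComplexPoints

section Fibres

variable {𝒳 : Scheme.{0}}

/-- The stalk of `ℒ` at `p` is a module over the local ring of `𝒳` at `p`. -/
instance stalkModule (ℒ : 𝒳.Modules) (p : 𝒳) :
    Module ↑(𝒳.presheaf.stalk p) ↑(ℒ.presheaf.stalk p) :=
  let M : PresheafOfModules (𝒳.presheaf ⋙ forget₂ CommRingCat RingCat) := ℒ.val
  inferInstanceAs (Module ↑(TopCat.Presheaf.stalk 𝒳.presheaf p)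
    ↑(TopCat.Presheaf.stalk M.presheaf p))

/-- The module structure on the stalk is the one that is induced by that on sections. -/
theorem germ_smul (ℒ : 𝒳.Modules) (p : 𝒳) (U : 𝒳.Opens) (hp : p ∈ U) (f : Γ(𝒳, U))
    (s : Γ(ℒ, U)) : ℒ.presheaf.germ U p hp (f • s) =
      𝒳.presheaf.germ U p hp f • ℒ.presheaf.germ U p hp s :=
  PresheafOfModules.germ_smul (R := 𝒳.presheaf) ℒ.val p U hp f s

/-- The local ring of `𝒳` at a complex point `x` acts on `ℂ` by evaluation at `x`. -/
instance evalAlgebra (x : ComplexPoints 𝒳) : Algebra ↑(𝒳.presheaf.stalk x.pt) ℂ :=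
  x.evalGerm.toAlgebra

/-- The fibre `L(x) = ℂ ⊗ ℒ_x` at a complex point `x`; the tensor product is over the local ring
of `𝒳` at `x`. -/
abbrev Fibre (ℒ : 𝒳.Modules) (x : ComplexPoints 𝒳) : Type :=
  ℂ ⊗[↑(𝒳.presheaf.stalk x.pt)] ↑(ℒ.presheaf.stalk x.pt)

/-- The value `s(x)` in the fibre `L(x)` of a section `s` of `ℒ` on a neighbourhood of `x`. -/
def valueAt (ℒ : 𝒳.Modules) {U : 𝒳.Opens} (s : Γ(ℒ, U)) (x : ComplexPoints 𝒳)
    (hx : x.pt ∈ U) : Fibre ℒ x :=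
  (1 : ℂ) ⊗ₜ[↑(𝒳.presheaf.stalk x.pt)] (ℒ.presheaf.germ U x.pt hx s)

/-- A continuous hermitian metric `‖·‖_φ` on the complex line bundle `L = ℒ(ℂ)` over `𝒳(ℂ)`. -/
structure HermitianMetric (ℒ : 𝒳.Modules) where
  norm : ∀ x : ComplexPoints 𝒳, Seminorm ℂ (Fibre ℒ x)
  definite : ∀ (x : ComplexPoints 𝒳) (v : Fibre ℒ x), norm x v = 0 → v = 0
  continuous : ∀ (U : 𝒳.Opens) (s : Γ(ℒ, U)),
    Continuous fun x : {x : ComplexPoints 𝒳 // x.pt ∈ U} => norm x.1 (valueAt ℒ s x.1 x.2)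

/-- The set-theoretic section `x ↦ v(x)` of `L` over `𝒳(ℂ)` that an element `v` of `H⁰(𝒳, ℒ)`
defines. -/
def analytify (ℒ : 𝒳.Modules) (v : Γ(ℒ, ⊤)) : ∀ x : ComplexPoints 𝒳, Fibre ℒ x :=
  fun x => valueAt ℒ v x trivial

/-- `s` is a holomorphic section of `L` over `𝒳(ℂ)`, that is, an element of `H⁰(X, L)`:
near every point it is a holomorphic multiple of an algebraic frame. -/
def IsHolomorphicSection (ℒ : 𝒳.Modules) (s : ∀ x : ComplexPoints 𝒳, Fibre ℒ x) : Prop :=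
  ∀ x : ComplexPoints 𝒳, ∃ (U : 𝒳.Opens) (_ : x.pt ∈ U) (e : Γ(ℒ, U))
    (f : ComplexPoints 𝒳 → ℂ), IsFrame ℒ U e ∧ ComplexPoints.HolomorphicAt f x ∧
      ∀ᶠ y in 𝓝 x, ∃ hy : y.pt ∈ U, s y = f y • valueAt ℒ e y hy

variable {ℒ : 𝒳.Modules} (φ : HermitianMetric ℒ) (μ : Measure (ComplexPoints 𝒳))

/-- The square `‖s‖²_{(μ, φ)} = ∫ ‖s(x)‖²_φ dμ` of the `L²`-norm. -/
def l2NormSq (s : ∀ x : ComplexPoints 𝒳, Fibre ℒ x) : ℝ≥0∞ :=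
  ∫⁻ x, ENNReal.ofReal (φ.norm x (s x) ^ 2) ∂μ

/-- The `L²`-norm on `H⁰(𝒳, ℒ) ⊗ ℂ` is invariant under complex conjugation: `∑ z ⊗ v` and
`∑ z̄ ⊗ v` have the same norm. -/
def ConjInvariant : Prop :=
  ∀ c : Γ(ℒ, ⊤) →₀ ℂ,
    l2NormSq φ μ (c.sum fun v z => z • analytify ℒ v) =
      l2NormSq φ μ (c.sum fun v z => (starRingEnd ℂ z) • analytify ℒ v)

/-- The Bergman distortion function
`ρ(μ, φ)(x) = sup { ‖s(x)‖²_φ / ‖s‖²_{(μ, φ)} | s ∈ H⁰(X, L) ∖ {0} }`. -/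
def bergmanDistortion (x : ComplexPoints 𝒳) : ℝ≥0∞ :=
  ⨆ (s : ∀ x : ComplexPoints 𝒳, Fibre ℒ x) (_ : IsHolomorphicSection ℒ s) (_ : s ≠ 0),
    ENNReal.ofReal (φ.norm x (s x) ^ 2) / l2NormSq φ μ s

/-- The Gaussian weight `exp(-π t ‖v‖²_{(μ, φ)})` of `v ∈ H⁰(𝒳, ℒ)`. -/
def gaussWeight (t : ℝ) (v : Γ(ℒ, ⊤)) : ℝ≥0∞ :=
  EReal.exp (-((ENNReal.ofReal (Real.pi * t) * l2NormSq φ μ (analytify ℒ v) : ℝ≥0∞) : EReal))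

/-- The theta invariant
`Θ(μ, φ)(t; x) = 2π ∑_v ‖v(x)‖²_φ exp(-π t ‖v‖²) / ∑_u exp(-π t ‖u‖²)`, where `v` and `u` run
through `H⁰(𝒳, ℒ)`. -/
def Theta (t : ℝ) (x : ComplexPoints 𝒳) : ℝ≥0∞ :=
  ENNReal.ofReal (2 * Real.pi) *
    ∑' v : Γ(ℒ, ⊤), ENNReal.ofReal (φ.norm x (analytify ℒ v x) ^ 2) *
      (gaussWeight φ μ t v / ∑' u : Γ(ℒ, ⊤), gaussWeight φ μ t u)

end Fibres

end ArithTheta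

end

/-! Take finitely many integral sections of finite norm, their real span V and the real L²-form B on
V. Conjugation invariance gives ‖s + it‖² = ‖s‖² + ‖t‖² for s, t in V. The real and imaginary parts
of evaluation at x are B-pairings with vectors k₁, k₂ of V. Testing the distortion on k₁ - i k₂
yields B(k₁, k₁) + B(k₂, k₂) ≤ ρ(x) (`exists_reInner_eq`).

It remains to compare covariances: with θ(w) = ∑ exp(-π B(l + w, l + w)) over the lattice, 2π ∑ B(l,
k)² exp(-π B(l, l)) ≤ B(k, k) θ(0) (`sum_sq_mul_formGaussian_le`). This is the second-order content
at w = 0 of θ(w) ≤ θ(0) (`shiftedTheta_le`).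

The latter needs no Poisson summation. The parallelogram law and 2ab ≤ a² + b² give 2θ(x)² ≤ θ(0)² +
θ(2x)θ(0), and passing to the supremum of θ finishes. The argument allows degenerate B and lattice
maps that are not injective. Working with finite partial sums avoids any finiteness statement about
H⁰. -/

namespace ArithTheta

noncomputable section

/-! ### Gaussian sums over translates of a lattice. -/

section Lattice

variable {Λ V : Type*} [AddCommGroup Λ] [AddCommGroup V] [Module ℝ V]

/-- The Gaussian `exp(-a B(v, v))` of a bilinear form `B`. -/
def formGaussian (B : V →ₗ[ℝ] V →ₗ[ℝ] ℝ) (a : ℝ) (v : V) : ℝ≥0∞ :=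
  ENNReal.ofReal (Real.exp (-(a * B v v)))

/-- The Gaussian sum over the translate by `w` of the image of `j`. -/
def shiftedTheta (B : V →ₗ[ℝ] V →ₗ[ℝ] ℝ) (j : Λ →+ V) (w : V) : ℝ≥0∞ :=
  ∑' l, formGaussian B Real.pi (j l + w)

theorem tsum_eq_tsum_fibre {α β : Type*} (q : α → β) (F : α → ℝ≥0∞) :
    ∑' p, F p = ∑' c, ∑' p : {p // q p = c}, F p := by
  rw [← (Equiv.sigmaFiberEquiv q).tsum_eq, ENNReal.tsum_sigma']
  rfl

/-- Summation over `d + 2Λ`, with the multiplicity coming from the `2`-torsion. -/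
theorem tsum_two_nsmul_add (G : Λ → ℝ≥0∞) (d : Λ) :
    ∑' v, G (2 • v + d) = (∑' _ : {v : Λ // 2 • v = 0}, (1 : ℝ≥0∞)) *
      ∑' p : {p : Λ // (QuotientAddGroup.mk p : Λ ⧸ (nsmulAddMonoidHom (α := Λ) 2).range) =
        QuotientAddGroup.mk d}, G p := by
  have hmem (v : Λ) : (QuotientAddGroup.mk (2 • v + d) :
      Λ ⧸ (nsmulAddMonoidHom (α := Λ) 2).range) = QuotientAddGroup.mk d := by
    rw [eq_comm, QuotientAddGroup.eq]
    exact ⟨v, by simp⟩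
  rw [tsum_eq_tsum_fibre (fun v => (⟨2 • v + d, hmem v⟩ : {p : Λ //
    (QuotientAddGroup.mk p : Λ ⧸ (nsmulAddMonoidHom (α := Λ) 2).range) = QuotientAddGroup.mk d})),
    ← ENNReal.tsum_mul_left]
  refine tsum_congr fun p => ?_
  obtain ⟨p, hp⟩ := p
  obtain ⟨v₀, hv₀⟩ := QuotientAddGroup.eq.1 hp.symm
  have hv₀' : 2 • v₀ + d = p := by
    rw [show 2 • v₀ = -d + p from hv₀]; abel
  have key : ∀ v : {v : Λ // (⟨2 • v + d, hmem v⟩ : {p : Λ //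
    (QuotientAddGroup.mk p : Λ ⧸ (nsmulAddMonoidHom (α := Λ) 2).range) = QuotientAddGroup.mk d})
      = ⟨p, hp⟩}, G (2 • v.1 + d) = 1 * G p := by
    rintro ⟨v, hv⟩
    rw [one_mul]
    exact congrArg G (congrArg Subtype.val hv)
  rw [tsum_congr key, ENNReal.tsum_mul_right]
  congr 1
  -- Each fibre of v ↦ 2v + d is a coset of the 2-torsion, based at v₀.
  let e : {v : Λ // 2 • v = 0} ≃ {v : Λ // (⟨2 • v + d, hmem v⟩ : {p : Λ //
      (QuotientAddGroup.mk p : Λ ⧸ (nsmulAddMonoidHom (α := Λ) 2).range) =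
        QuotientAddGroup.mk d}) = ⟨p, hp⟩} :=
    { toFun := fun v => ⟨v.1 + v₀, Subtype.ext (by
        change 2 • (v.1 + v₀) + d = p
        rw [smul_add, v.2, zero_add, hv₀'])⟩
      invFun := fun v => ⟨v.1 - v₀, by
        have h : 2 • v.1 + d = p := congrArg Subtype.val v.2
        rw [smul_sub, sub_eq_zero]
        exact add_right_cancel (h.trans hv₀'.symm)⟩
      left_inv := fun v => Subtype.ext (add_sub_cancel_right _ _)
      right_inv := fun v => Subtype.ext (sub_add_cancel _ _) }
  exact (e.tsum_eq fun _ => (1 : ℝ≥0∞)).symm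

theorem ENNReal_two_mul_le_sq_add_sq (a b : ℝ≥0∞) : 2 * (a * b) ≤ a * a + b * b := by
  induction a with
  | top => simp
  | coe a =>
    induction b with
    | top => simp
    | coe b =>
      norm_cast
      have := two_mul_le_add_sq (a : ℝ) b
      rw [← NNReal.coe_le_coe]
      push_cast
      linarith

variable {B : V →ₗ[ℝ] V →ₗ[ℝ] ℝ} (j : Λ →+ V)

theorem formGaussian_ne_top {a : ℝ} {v : V} : formGaussian B a v ≠ ∞ :=
  ENNReal.ofReal_ne_top

/-- The parallelogram law, exponentiated. -/
theorem formGaussian_mul (hB : ∀ v w, B v w = B w v) (p q : V) :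
    formGaussian B Real.pi p * formGaussian B Real.pi q =
      formGaussian B (Real.pi / 2) (p - q) * formGaussian B (Real.pi / 2) (p + q) := by
  simp only [formGaussian]
  rw [← ENNReal.ofReal_mul (Real.exp_pos _).le, ← ENNReal.ofReal_mul (Real.exp_pos _).le,
    ← Real.exp_add, ← Real.exp_add]
  congr 2
  simp only [map_add, map_sub, LinearMap.add_apply, LinearMap.sub_apply, hB q p]
  ring

/-- Rotating a pair of lattice indices to their difference and sum gives exactly the pairs that
agree modulo 2Λ, whence the sum over cosets. -/
theorem shiftedTheta_mul (hB : ∀ v w, B v w = B w v) (x y : V) :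
    shiftedTheta B j x * shiftedTheta B j y = (∑' _ : {v : Λ // 2 • v = 0}, (1 : ℝ≥0∞)) *
      ∑' c : Λ ⧸ (nsmulAddMonoidHom (α := Λ) 2).range,
        (∑' p : {p : Λ // QuotientAddGroup.mk p = c}, formGaussian B (Real.pi / 2) (j p + (x - y))) *
        ∑' p : {p : Λ // QuotientAddGroup.mk p = c},
          formGaussian B (Real.pi / 2) (j p + (x + y)) := by
  have h1 : shiftedTheta B j x * shiftedTheta B j y =
      ∑' d, ∑' v, formGaussian B (Real.pi / 2) (j d + (x - y)) *
        formGaussian B (Real.pi / 2) (j (2 • v + d) + (x + y)) := by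
    rw [mul_comm]
    simp only [shiftedTheta]
    rw [← ENNReal.tsum_mul_right, ENNReal.tsum_comm]
    refine tsum_congr fun v => ?_
    -- After this shift d is the difference of the two indices, and their sum is 2v + d.
    rw [← ENNReal.tsum_mul_left, ← (Equiv.addRight v).tsum_eq]
    refine tsum_congr fun d => ?_
    rw [mul_comm, formGaussian_mul hB]
    simp only [Equiv.coe_addRight, map_add, map_nsmul]
    congr 2 <;> module
  rw [h1, tsum_eq_tsum_fibre
    (fun p => (QuotientAddGroup.mk p : Λ ⧸ (nsmulAddMonoidHom (α := Λ) 2).range)),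
    ← ENNReal.tsum_mul_left]
  refine tsum_congr fun c => ?_
  rw [mul_left_comm, ← ENNReal.tsum_mul_right]
  refine tsum_congr fun d => ?_
  rw [ENNReal.tsum_mul_left,
    tsum_two_nsmul_add (fun p => formGaussian B (Real.pi / 2) (j p + (x + y))), d.2]

/-- For the pairs (x - y, 0) and (x + y, 0) the product formula is a sum of squares of the coset
sums that occur mixed for (x, y); compare coset by coset. -/
theorem two_mul_shiftedTheta_mul_le (hB : ∀ v w, B v w = B w v) (x y : V) :
    2 * (shiftedTheta B j x * shiftedTheta B j y) ≤
      shiftedTheta B j (x - y) * shiftedTheta B j 0 +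
        shiftedTheta B j (x + y) * shiftedTheta B j 0 := by
  simp only [shiftedTheta_mul j hB, sub_zero, add_zero]
  rw [mul_left_comm, ← mul_add, ← ENNReal.tsum_add, ← ENNReal.tsum_mul_left]
  gcongr
  exact ENNReal_two_mul_le_sq_add_sq _ _

theorem shiftedTheta_add_map (w : V) (l : Λ) :
    shiftedTheta B j (w + j l) = shiftedTheta B j w := by
  simp only [shiftedTheta]
  rw [← (Equiv.addRight l).tsum_eq fun v => formGaussian B Real.pi (j v + w)]
  refine tsum_congr fun v => ?_
  simp only [Equiv.coe_addRight, map_add]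
  congr 1
  abel

theorem shiftedTheta_map (l : Λ) : shiftedTheta B j (j l) = shiftedTheta B j 0 := by
  rw [← zero_add (j l), shiftedTheta_add_map]

theorem formGaussian_add (hB : ∀ v w, B v w = B w v) (v w : V) :
    formGaussian B Real.pi (v + w) = formGaussian B Real.pi v *
      ENNReal.ofReal (Real.exp (-(2 * Real.pi * B v w) - Real.pi * B w w)) := by
  simp only [formGaussian]
  rw [← ENNReal.ofReal_mul (Real.exp_pos _).le, ← Real.exp_add]
  congr 2
  simp only [map_add, LinearMap.add_apply, hB w v]
  ring

/-- On a fundamental parallelepiped, the Gaussian sum is bounded by its values at the vertices. -/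
theorem shiftedTheta_sum_smul_le (hB : ∀ v w, B v w = B w v) (hpos : ∀ v, 0 ≤ B v v)
    {ι : Type*} [Fintype ι] (g : ι → Λ) (t : ι → ℝ) (h0 : ∀ i, 0 ≤ t i) (h1 : ∀ i, t i ≤ 1) :
    shiftedTheta B j (∑ i, t i • j (g i)) ≤
      (∑ T : Finset ι, ENNReal.ofReal
        (Real.exp (Real.pi * B (j (∑ i ∈ T, g i)) (j (∑ i ∈ T, g i))))) * shiftedTheta B j 0 := by
  classical
  rw [Finset.sum_mul]
  -- The vertices are lattice points, so each copy of θ(0) may be replaced by θ at a vertex.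
  rw [Finset.sum_congr rfl fun T _ => congrArg (_ * ·)
    (shiftedTheta_map (B := B) j (∑ i ∈ T, g i)).symm]
  simp only [shiftedTheta, ← ENNReal.tsum_mul_left]
  rw [← Summable.tsum_finsetSum fun _ _ => ENNReal.summable]
  refine ENNReal.tsum_le_tsum fun v => ?_
  -- The exponent -2π B(v, w) is linear in t, hence largest at the vertex with tᵢ = 1 exactly where
  -- B(v, gᵢ) < 0. The prefactor of that vertex cancels its own quadratic term.
  refine le_trans ?_ (Finset.single_le_sum (fun _ _ => zero_le)
    (Finset.mem_univ (Finset.univ.filter fun i => B (j v) (j (g i)) < 0)))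
  rw [formGaussian_add hB, formGaussian_add hB, mul_left_comm,
    ← ENNReal.ofReal_mul (Real.exp_pos _).le, ← Real.exp_add]
  gcongr
  have h2 := mul_nonneg Real.pi_pos.le (hpos (∑ i, t i • j (g i)))
  have h3 : B (j v) (j (∑ i ∈ Finset.univ.filter fun i => B (j v) (j (g i)) < 0, g i)) ≤
      B (j v) (∑ i, t i • j (g i)) := by
    simp only [map_sum, map_smul, smul_eq_mul, Finset.sum_filter]
    refine Finset.sum_le_sum fun i _ => ?_
    split_ifs with h
    · nlinarith [h1 i]
    · simpa using mul_nonneg (h0 i) (not_lt.1 h)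
  nlinarith [Real.pi_pos]

/-- Periodicity moves w into a parallelepiped by taking fractional parts. Only boundedness matters
here: the supremum argument below improves the constant to 1. -/
theorem exists_shiftedTheta_le (hB : ∀ v w, B v w = B w v) (hpos : ∀ v, 0 ≤ B v v)
    {ι : Type*} [Fintype ι] (g : ι → Λ) (hg : Submodule.span ℝ (Set.range fun i => j (g i)) = ⊤) :
    ∃ C : ℝ≥0∞, C ≠ ∞ ∧ ∀ w, shiftedTheta B j w ≤ C * shiftedTheta B j 0 := by
  refine ⟨∑ T : Finset ι, ENNReal.ofReal
    (Real.exp (Real.pi * B (j (∑ i ∈ T, g i)) (j (∑ i ∈ T, g i)))),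
    ENNReal.sum_ne_top.2 fun _ _ => ENNReal.ofReal_ne_top, fun w => ?_⟩
  obtain ⟨c, rfl⟩ := (Submodule.mem_span_range_iff_exists_fun ℝ).1
    (hg ▸ Submodule.mem_top : w ∈ Submodule.span ℝ (Set.range fun i => j (g i)))
  have h : ∑ i, c i • j (g i) = ∑ i, Int.fract (c i) • j (g i) + j (∑ i, ⌊c i⌋ • g i) := by
    rw [map_sum, ← Finset.sum_add_distrib]
    refine Finset.sum_congr rfl fun i _ => ?_
    rw [map_zsmul, ← Int.cast_smul_eq_zsmul ℝ, ← add_smul, Int.fract_add_floor]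
  rw [h, shiftedTheta_add_map]
  exact shiftedTheta_sum_smul_le j hB hpos g _ (fun i => Int.fract_nonneg _)
    fun i => (Int.fract_lt_one _).le

/-- The Gaussian sum over a translate of a lattice is largest for the lattice itself. -/
theorem shiftedTheta_le (hB : ∀ v w, B v w = B w v) (hpos : ∀ v, 0 ≤ B v v)
    {ι : Type*} [Fintype ι] (g : ι → Λ) (hg : Submodule.span ℝ (Set.range fun i => j (g i)) = ⊤)
    (h0 : shiftedTheta B j 0 ≠ ∞) (w : V) : shiftedTheta B j w ≤ shiftedTheta B j 0 := by
  obtain ⟨C, hC, hb⟩ := exists_shiftedTheta_le j hB hpos g hg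
  have hC0 := ENNReal.mul_ne_top hC h0
  have hfin (w : V) : shiftedTheta B j w ≠ ∞ := ne_top_of_le_ne_top hC0 (hb w)
  set f : V → ℝ := fun w => (shiftedTheta B j w).toReal with hf
  have hbdd : BddAbove (Set.range f) :=
    ⟨_, Set.forall_mem_range.2 fun w => ENNReal.toReal_mono hC0 (hb w)⟩
  have hfn (w : V) : 0 ≤ f w := ENNReal.toReal_nonneg
  have hsq (x : V) : 2 * (f x * f x) ≤ f 0 * f 0 + f (x + x) * f 0 := by
    have h := two_mul_shiftedTheta_mul_le j hB x x
    rw [sub_self] at h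
    have h' := ENNReal.toReal_mono (ENNReal.add_ne_top.2 ⟨ENNReal.mul_ne_top (hfin _) (hfin _),
      ENNReal.mul_ne_top (hfin _) (hfin _)⟩) h
    rwa [ENNReal.toReal_add (ENNReal.mul_ne_top (hfin _) (hfin _))
      (ENNReal.mul_ne_top (hfin _) (hfin _)), ENNReal.toReal_mul, ENNReal.toReal_mul,
      ENNReal.toReal_mul, ENNReal.toReal_mul] at h'
  set M := ⨆ w, f w
  have hM (w : V) : f w ≤ M := le_ciSup hbdd w
  have hMsq : M ≤ Real.sqrt ((f 0 * f 0 + M * f 0) / 2) := by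
    refine ciSup_le fun x => Real.le_sqrt_of_sq_le ?_
    nlinarith [hsq x, mul_le_mul_of_nonneg_right (hM (x + x)) (hfn 0)]
  have hM0 : 0 ≤ M := (hfn 0).trans (hM 0)
  rw [Real.le_sqrt hM0 (by nlinarith [hfn 0, mul_nonneg hM0 (hfn 0)])] at hMsq
  -- The bound 2M² ≤ f(0)² + M f(0) factors as (M - f(0))(2M + f(0)) ≤ 0.
  have hle : M ≤ f 0 := by
    by_contra! hlt
    nlinarith [hfn 0]
  exact (ENNReal.toReal_le_toReal (hfin _) h0).1 ((hM w).trans hle)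

/-! ### Covariance of the discrete Gaussian. -/

theorem two_add_sq_le_exp_add_exp_neg (a : ℝ) : 2 + a ^ 2 ≤ Real.exp a + Real.exp (-a) := by
  have h1 : Real.exp a + Real.exp (-a) = 2 * Real.cosh (2 * (a / 2)) := by
    rw [mul_div_cancel₀ a two_ne_zero, Real.cosh_eq]
    ring
  have h2 : (a / 2) ^ 2 ≤ Real.sinh (a / 2) ^ 2 := by
    rw [sq_le_sq]
    rcases le_total 0 (a / 2) with h | h
    · rw [abs_of_nonneg h, abs_of_nonneg (Real.sinh_nonneg_iff.2 h)]
      exact Real.self_le_sinh_iff.2 h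
    · rw [abs_of_nonpos h, abs_of_nonpos (Real.sinh_nonpos_iff.2 h)]
      exact neg_le_neg (Real.sinh_le_self_iff.2 h)
  rw [h1, Real.cosh_two_mul]
  nlinarith [Real.cosh_sq (a / 2)]

/-- The covariance of the discrete Gaussian distribution on a lattice is at most that of the
continuous one. -/
theorem sum_sq_mul_formGaussian_le (hB : ∀ v w, B v w = B w v) (hpos : ∀ v, 0 ≤ B v v)
    {ι : Type*} [Fintype ι] (g : ι → Λ) (hg : Submodule.span ℝ (Set.range fun i => j (g i)) = ⊤)
    (h0 : shiftedTheta B j 0 ≠ ∞) (F : Finset Λ) (k : V) :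
    2 * Real.pi * ∑ l ∈ F, B (j l) k ^ 2 * Real.exp (-(Real.pi * B (j l) (j l))) ≤
      B k k * (shiftedTheta B j 0).toReal := by
  set S := (shiftedTheta B j 0).toReal with hS
  set A := ∑ l ∈ F, B (j l) k ^ 2 * Real.exp (-(Real.pi * B (j l) (j l))) with hA
  have hS0 : 0 ≤ S := ENNReal.toReal_nonneg
  have hsum : Summable fun l => Real.exp (-(Real.pi * B (j l) (j l))) := by
    have := ENNReal.summable_toReal h0
    simpa [formGaussian, ENNReal.toReal_ofReal (Real.exp_pos _).le] using this
  have hSsum : ∑' l, Real.exp (-(Real.pi * B (j l) (j l))) = S := by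
    rw [hS, shiftedTheta, ENNReal.tsum_toReal_eq fun l => formGaussian_ne_top]
    simp [formGaussian, ENNReal.toReal_ofReal (Real.exp_pos _).le]
  -- Add θ(w) ≤ θ(0) and θ(-w) ≤ θ(0), each multiplied by exp(π B(w, w)), and bound the resulting
  -- exp(a) + exp(-a) below by 2 + a².
  have hmain (w : V) : 4 * Real.pi ^ 2 * ∑ l ∈ F, B (j l) w ^ 2 *
      Real.exp (-(Real.pi * B (j l) (j l))) + 2 * S ≤ 2 * (Real.exp (Real.pi * B w w) * S) := by
    have hshift (w : V) : (Summable fun l => Real.exp (-(Real.pi * B (j l) (j l))) *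
        Real.exp (-(2 * Real.pi * B (j l) w))) ∧
        ∑' l, Real.exp (-(Real.pi * B (j l) (j l))) * Real.exp (-(2 * Real.pi * B (j l) w)) ≤
          Real.exp (Real.pi * B w w) * S := by
      have hle := shiftedTheta_le j hB hpos g hg h0 w
      have hfin := ne_top_of_le_ne_top h0 hle
      have heq (l : Λ) : Real.exp (-(Real.pi * B (j l) (j l))) *
          Real.exp (-(2 * Real.pi * B (j l) w)) =
          Real.exp (Real.pi * B w w) * (formGaussian B Real.pi (j l + w)).toReal := by
        rw [formGaussian, ENNReal.toReal_ofReal (Real.exp_pos _).le, ← Real.exp_add,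
          ← Real.exp_add]
        congr 1
        simp only [map_add, LinearMap.add_apply, hB w (j l)]
        ring
      simp only [heq]
      refine ⟨(ENNReal.summable_toReal hfin).mul_left _, ?_⟩
      rw [tsum_mul_left, ← ENNReal.tsum_toReal_eq fun l => formGaussian_ne_top]
      gcongr
      exact ENNReal.toReal_mono h0 hle
    obtain ⟨hs1, hl1⟩ := hshift w
    obtain ⟨hs2, hl2⟩ := hshift (-w)
    simp only [map_neg, LinearMap.neg_apply, neg_neg, mul_neg] at hs2 hl2
    have hpt (l : Λ) : 4 * Real.pi ^ 2 * (B (j l) w ^ 2 * Real.exp (-(Real.pi * B (j l) (j l)))) ≤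
        Real.exp (-(Real.pi * B (j l) (j l))) * Real.exp (-(2 * Real.pi * B (j l) w)) +
        Real.exp (-(Real.pi * B (j l) (j l))) * Real.exp (2 * Real.pi * B (j l) w) -
        2 * Real.exp (-(Real.pi * B (j l) (j l))) := by
      nlinarith [mul_le_mul_of_nonneg_left
        (two_add_sq_le_exp_add_exp_neg (2 * Real.pi * B (j l) w))
        (Real.exp_pos (-(Real.pi * B (j l) (j l)))).le]
    have hs3 := (hs1.add hs2).sub (hsum.mul_left 2)
    have hfs := hs3.sum_le_tsum F fun l _ => le_trans (by positivity) (hpt l)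
    rw [(hs1.add hs2).tsum_sub (hsum.mul_left 2), hs1.tsum_add hs2, tsum_mul_left, hSsum] at hfs
    have := Finset.sum_le_sum fun l (_ : l ∈ F) => hpt l
    rw [← Finset.mul_sum] at this
    linarith
  -- Put w = tk, use exp(u) - 1 ≤ u exp(u) and divide by 2πt²; the limit t → 0 removes the
  -- exponential.
  have hscale (t : ℝ) (ht : 0 < t) :
      2 * Real.pi * A ≤ B k k * Real.exp (Real.pi * (t ^ 2 * B k k)) * S := by
    have h := hmain (t • k)
    simp only [map_smul, LinearMap.smul_apply, smul_eq_mul, mul_pow, mul_assoc (t ^ 2)] at h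
    rw [← Finset.mul_sum, ← hA, ← mul_assoc t, ← sq] at h
    have hexp : Real.exp (Real.pi * (t ^ 2 * B k k)) - 1 ≤
        Real.pi * (t ^ 2 * B k k) * Real.exp (Real.pi * (t ^ 2 * B k k)) := by
      have h3 := Real.add_one_le_exp (-(Real.pi * (t ^ 2 * B k k)))
      have h4 := mul_le_mul_of_nonneg_right h3 (Real.exp_pos (Real.pi * (t ^ 2 * B k k))).le
      rw [← Real.exp_add, neg_add_cancel, Real.exp_zero] at h4
      linarith
    have h5 := mul_le_mul_of_nonneg_right hexp hS0
    have h6 : 0 < 2 * Real.pi * t ^ 2 := by positivity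
    refine le_of_mul_le_mul_left ?_ h6
    linarith
  have hlim : Filter.Tendsto
      (fun t : ℝ => B k k * Real.exp (Real.pi * (t ^ 2 * B k k)) * S) (𝓝[>] 0)
      (𝓝 (B k k * Real.exp (Real.pi * ((0 : ℝ) ^ 2 * B k k)) * S)) :=
    Continuous.tendsto' (by fun_prop) _ _ rfl |>.mono_left nhdsWithin_le_nhds
  have := ge_of_tendsto hlim (Filter.eventually_of_mem self_mem_nhdsWithin hscale)
  simpa using this

end Lattice


/-! ### Real L²-forms and evaluation functionals. -/

section SquareIntegrable

/-- A functional that is bounded with respect to a positive semidefinite form is represented by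
a vector. -/
theorem exists_form_eq_of_sq_le {V : Type*} [AddCommGroup V] [Module ℝ V] [FiniteDimensional ℝ V]
    {B : V →ₗ[ℝ] V →ₗ[ℝ] ℝ} (f : V →ₗ[ℝ] ℝ) (r : ℝ) (hf : ∀ s, f s ^ 2 ≤ r * B s s) :
    ∃ k, ∀ s, f s = B k s := by
  -- The bound forces f to vanish wherever B(s, s) = 0; in finite dimension this puts f in the range
  -- of B.
  have h : f ∈ (LinearMap.range B).dualCoannihilator.dualAnnihilator := by
    rw [Submodule.mem_dualAnnihilator]
    intro s hs
    have h0 : B s s = 0 := (Submodule.mem_dualCoannihilator s).1 hs (B s) ⟨s, rfl⟩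
    have := hf s
    rw [h0, mul_zero] at this
    exact pow_eq_zero_iff two_ne_zero |>.1 (le_antisymm this (sq_nonneg _))
  rw [Subspace.dualCoannihilator_dualAnnihilator_eq] at h
  obtain ⟨k, hk⟩ := h
  exact ⟨k, fun s => by rw [hk]⟩

variable {X : Type*} [MeasurableSpace X] {μ : Measure X}

theorem norm_add_sq_le_two_mul {E : Type*} [SeminormedAddCommGroup E] (a b : E) :
    ‖a + b‖ ^ 2 ≤ 2 * ‖a‖ ^ 2 + 2 * ‖b‖ ^ 2 := by
  have := norm_add_le a b
  nlinarith [norm_nonneg (a + b), sq_nonneg (‖a‖ - ‖b‖)]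

theorem re_mul_conj_eq (a b : ℂ) :
    (a * starRingEnd ℂ b).re = (‖a + b‖ ^ 2 - ‖a - b‖ ^ 2) / 4 := by
  simp only [Complex.sq_norm, Complex.normSq_apply, Complex.mul_re, Complex.conj_re,
    Complex.conj_im, Complex.add_re, Complex.add_im, Complex.sub_re, Complex.sub_im]
  ring

variable (V : Submodule ℝ (X → ℂ)) (hV : ∀ s ∈ V, Integrable (fun x => ‖s x‖ ^ 2) μ)

-- By polarization: only the absolute values of the functions are controlled, as the functions
-- themselves need not be measurable.
include hV in
theorem integrable_re_mul_conj (s t : V) :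
    Integrable (fun x => (s.1 x * starRingEnd ℂ (t.1 x)).re) μ := by
  simp only [re_mul_conj_eq]
  exact ((hV _ (s + t).2).sub (hV _ (s - t).2)).div_const 4

/-- The real inner product on a space of functions whose absolute values are square integrable. -/
def reInner : V →ₗ[ℝ] V →ₗ[ℝ] ℝ :=
  LinearMap.mk₂ ℝ (fun s t => ∫ x, (s.1 x * starRingEnd ℂ (t.1 x)).re ∂μ)
    (fun s s' t => by
      rw [← integral_add (integrable_re_mul_conj V hV s t) (integrable_re_mul_conj V hV s' t)]
      simp [add_mul])
    (fun c s t => by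
      rw [smul_eq_mul, ← integral_const_mul]
      simp [mul_assoc])
    (fun s t t' => by
      rw [← integral_add (integrable_re_mul_conj V hV s t) (integrable_re_mul_conj V hV s t')]
      simp [mul_add])
    (fun c s t => by
      rw [smul_eq_mul, ← integral_const_mul]
      simp [mul_left_comm])

theorem reInner_comm (s t : V) : reInner V hV s t = reInner V hV t s := by
  refine integral_congr_ae (.of_forall fun x => ?_)
  simp [mul_comm]

theorem reInner_self (s : V) : reInner V hV s s = ∫ x, ‖s.1 x‖ ^ 2 ∂μ := by
  refine integral_congr_ae (.of_forall fun x => ?_)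
  simp only [Complex.sq_norm, Complex.mul_conj, Complex.ofReal_re]

theorem reInner_self_nonneg (s : V) : 0 ≤ reInner V hV s s := by
  rw [reInner_self]
  exact integral_nonneg fun x => sq_nonneg _

theorem lintegral_norm_sq_eq_reInner (s : V) :
    ∫⁻ x, ENNReal.ofReal (‖s.1 x‖ ^ 2) ∂μ = ENNReal.ofReal (reInner V hV s s) := by
  rw [reInner_self, ofReal_integral_eq_lintegral_ofReal (hV _ s.2)
    (.of_forall fun x => sq_nonneg _)]

/-- If the `L²`-norm is invariant under conjugation, then a bound for the complex evaluation
functional at `x` in terms of the `L²`-norm is a bound for its real and imaginary parts. -/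
theorem exists_reInner_eq [FiniteDimensional ℝ V]
    (hmeas : ∀ s t : V, Measurable fun x => ‖(s.1 + Complex.I • t.1) x‖)
    (hconj : ∀ s t : V, ∫⁻ x, ENNReal.ofReal (‖(s.1 + Complex.I • t.1) x‖ ^ 2) ∂μ =
      ∫⁻ x, ENNReal.ofReal (‖(s.1 - Complex.I • t.1) x‖ ^ 2) ∂μ) (x : X) (r : NNReal)
    (hle : ∀ s t : V, ∫⁻ x, ENNReal.ofReal (‖(s.1 + Complex.I • t.1) x‖ ^ 2) ∂μ ≠ ∞ →
      ENNReal.ofReal (‖(s.1 + Complex.I • t.1) x‖ ^ 2) ≤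
        r * ∫⁻ x, ENNReal.ofReal (‖(s.1 + Complex.I • t.1) x‖ ^ 2) ∂μ) :
    ∃ k₁ k₂ : V, reInner V hV k₁ k₁ + reInner V hV k₂ k₂ ≤ r ∧
      ∀ s : V, ‖s.1 x‖ ^ 2 = reInner V hV s k₁ ^ 2 + reInner V hV s k₂ ^ 2 := by
  -- Conjugation invariance makes the two diagonals in the parallelogram law equal.
  have hL (s t : V) : ∫⁻ x, ENNReal.ofReal (‖(s.1 + Complex.I • t.1) x‖ ^ 2) ∂μ =
      ENNReal.ofReal (reInner V hV s s + reInner V hV t t) := by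
    have h2 : 2 * ∫⁻ x, ENNReal.ofReal (‖(s.1 + Complex.I • t.1) x‖ ^ 2) ∂μ =
        2 * ENNReal.ofReal (reInner V hV s s + reInner V hV t t) := by
      rw [ENNReal.ofReal_add (reInner_self_nonneg V hV s) (reInner_self_nonneg V hV t),
        ← lintegral_norm_sq_eq_reInner, ← lintegral_norm_sq_eq_reInner, two_mul]
      nth_rw 2 [hconj]
      have hs : Measurable fun x => ‖s.1 x‖ := by simpa using hmeas s 0
      rw [← lintegral_add_left ((hmeas s t).pow_const 2).ennreal_ofReal,
        ← lintegral_add_left (hs.pow_const 2).ennreal_ofReal, ← lintegral_const_mul' _ _ (by simp)]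
      refine lintegral_congr fun y => ?_
      rw [← ENNReal.ofReal_add (by positivity) (by positivity),
        ← ENNReal.ofReal_add (by positivity) (by positivity),
        ← ENNReal.ofReal_ofNat, ← ENNReal.ofReal_mul (by positivity)]
      congr 1
      simp only [Complex.sq_norm, Complex.normSq_apply, Pi.add_apply, Pi.sub_apply, Pi.smul_apply,
        smul_eq_mul, Complex.add_re, Complex.add_im, Complex.sub_re, Complex.sub_im,
        Complex.mul_re, Complex.mul_im, Complex.I_re, Complex.I_im]
      ring
    exact (ENNReal.mul_right_inj (by simp) (by simp)).1 h2
  have hle' (s t : V) : ‖(s.1 + Complex.I • t.1) x‖ ^ 2 ≤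
      r * (reInner V hV s s + reInner V hV t t) := by
    have h := hle s t (by rw [hL]; exact ENNReal.ofReal_ne_top)
    rw [hL, ← ENNReal.ofReal_coe_nnreal, ← ENNReal.ofReal_mul r.coe_nonneg] at h
    exact (ENNReal.ofReal_le_ofReal_iff (mul_nonneg r.2 (add_nonneg (reInner_self_nonneg V hV s)
      (reInner_self_nonneg V hV t)))).1 h
  have hx (s : V) : ‖s.1 x‖ ^ 2 ≤ r * reInner V hV s s := by simpa using hle' s 0
  let ev : V →ₗ[ℝ] ℂ := (LinearMap.proj x : (X → ℂ) →ₗ[ℝ] ℂ) ∘ₗ V.subtype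
  obtain ⟨k₁, hk₁⟩ := exists_form_eq_of_sq_le (B := reInner V hV) (Complex.reLm ∘ₗ ev) r
    fun s => (sq_le_sq.2 ((Complex.abs_re_le_norm (s.1 x)).trans (le_abs_self _))).trans (hx s)
  obtain ⟨k₂, hk₂⟩ := exists_form_eq_of_sq_le (B := reInner V hV) (Complex.imLm ∘ₗ ev) r
    fun s => (sq_le_sq.2 ((Complex.abs_im_le_norm (s.1 x)).trans (le_abs_self _))).trans (hx s)
  replace hk₁ (s : V) : (s.1 x).re = reInner V hV k₁ s := hk₁ s
  replace hk₂ (s : V) : (s.1 x).im = reInner V hV k₂ s := hk₂ s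
  refine ⟨k₁, k₂, ?_, fun s => ?_⟩
  -- With c = B(k₁, k₁) + B(k₂, k₂), the function k₁ - i k₂ takes the value c at x (the imaginary
  -- part cancels by symmetry) and has squared norm c. Thus c² ≤ rc.
  · have h := hle' k₁ (-k₂)
    have h1 := reInner_self_nonneg V hV k₁
    have h2 := reInner_self_nonneg V hV k₂
    have h3 : (k₁.1 + Complex.I • (-k₂).1) x =
        ((reInner V hV k₁ k₁ + reInner V hV k₂ k₂ : ℝ) : ℂ) := by
      apply Complex.ext
      · simp [hk₁, hk₂]
      · simp [hk₁, hk₂, reInner_comm V hV k₂ k₁]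
    rw [h3, Complex.norm_real, Real.norm_of_nonneg (add_nonneg h1 h2)] at h
    simp only [map_neg, LinearMap.neg_apply, neg_neg] at h
    by_contra! hlt
    nlinarith [r.2]
  · rw [Complex.sq_norm, Complex.normSq_apply, hk₁, hk₂, reInner_comm V hV s k₁,
      reInner_comm V hV s k₂]
    ring

theorem integrable_norm_sq_of_mem_span {S : Set (X → ℂ)}
    (hmeas : ∀ s ∈ Submodule.span ℝ S, Measurable fun x => ‖s x‖)
    (hfin : ∀ s ∈ S, ∫⁻ x, ENNReal.ofReal (‖s x‖ ^ 2) ∂μ ≠ ∞) :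
    ∀ s ∈ Submodule.span ℝ S, Integrable (fun x => ‖s x‖ ^ 2) μ := by
  intro s hs
  induction hs using Submodule.span_induction with
  | mem s hs =>
    exact (lintegral_ofReal_ne_top_iff_integrable
      ((hmeas s (Submodule.subset_span hs)).pow_const 2).aestronglyMeasurable
      (.of_forall fun x => sq_nonneg _)).1 (hfin s hs)
  | zero => simp
  | add s t hs ht ihs iht =>
    refine ((ihs.const_mul 2).add (iht.const_mul 2)).mono'
      ((hmeas _ (add_mem hs ht)).pow_const 2).aestronglyMeasurable (.of_forall fun x => ?_)
    rw [Real.norm_of_nonneg (sq_nonneg _)]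
    exact norm_add_sq_le_two_mul _ _
  | smul c s hs ihs =>
    simpa [mul_pow] using ihs.const_mul (c ^ 2)

theorem EReal_exp_neg_ofReal (r : ℝ) (hr : 0 ≤ r) :
    EReal.exp (-((ENNReal.ofReal r : ℝ≥0∞) : EReal)) = ENNReal.ofReal (Real.exp (-r)) := by
  rw [EReal.coe_ennreal_ofReal, max_eq_left hr, ← EReal.coe_neg, EReal.exp_coe]

/-! ### The theta inequality for a group of functions. -/

variable {Γ : Type*} [AddCommGroup Γ] (a : Γ →+ (X → ℂ))

/-- The Gaussian weight of an element of a group of functions. -/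
def l2Weight (μ : Measure X) (s : X → ℂ) : ℝ≥0∞ :=
  EReal.exp (-((ENNReal.ofReal (Real.pi * 1) *
    ∫⁻ x, ENNReal.ofReal (‖s x‖ ^ 2) ∂μ : ℝ≥0∞) : EReal))

theorem l2Weight_eq (s : V) :
    l2Weight μ s.1 = formGaussian (reInner V hV) Real.pi s := by
  rw [l2Weight, lintegral_norm_sq_eq_reInner V hV, mul_one, ← ENNReal.ofReal_mul Real.pi_pos.le,
    EReal_exp_neg_ofReal _ (mul_nonneg Real.pi_pos.le (reInner_self_nonneg V hV s)), formGaussian]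

theorem l2Weight_of_eq_top {s : X → ℂ} (hs : ∫⁻ x, ENNReal.ofReal (‖s x‖ ^ 2) ∂μ = ∞) :
    l2Weight μ s = 0 := by
  rw [l2Weight, hs, ENNReal.mul_top (by simpa using Real.pi_pos)]
  simp

/-- The covariance bound is applied to the subgroup generated by F, for k₁ and k₂ separately. Its
Gaussian sum is at most that of the whole group. -/
theorem sum_norm_sq_mul_l2Weight_le
    (hmeas : ∀ s ∈ Submodule.span ℂ (Set.range a), Measurable fun x => ‖s x‖)
    (hconj : ∀ s ∈ Submodule.span ℝ (Set.range a), ∀ t ∈ Submodule.span ℝ (Set.range a),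
      ∫⁻ x, ENNReal.ofReal (‖(s + Complex.I • t) x‖ ^ 2) ∂μ =
      ∫⁻ x, ENNReal.ofReal (‖(s - Complex.I • t) x‖ ^ 2) ∂μ) (x : X) (r : NNReal)
    (hle : ∀ s ∈ Submodule.span ℂ (Set.range a), ∫⁻ x, ENNReal.ofReal (‖s x‖ ^ 2) ∂μ ≠ ∞ →
      ENNReal.ofReal (‖s x‖ ^ 2) ≤ r * ∫⁻ x, ENNReal.ofReal (‖s x‖ ^ 2) ∂μ)
    (hS : ∑' u, l2Weight μ (a u) ≠ ∞) (F : Finset Γ)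
    (hF : ∀ v ∈ F, ∫⁻ x, ENNReal.ofReal (‖a v x‖ ^ 2) ∂μ ≠ ∞) :
    ENNReal.ofReal (2 * Real.pi) * ∑ v ∈ F, ENNReal.ofReal (‖a v x‖ ^ 2) * l2Weight μ (a v) ≤
      r * ∑' u, l2Weight μ (a u) := by
  classical
  set V := Submodule.span ℝ (a '' (F : Set Γ))
  have hVR : V ≤ Submodule.span ℝ (Set.range a) :=
    Submodule.span_mono (Set.image_subset_range _ _)
  have hRC {s : X → ℂ} (hs : s ∈ Submodule.span ℝ (Set.range a)) :
      s ∈ Submodule.span ℂ (Set.range a) := Submodule.span_le_restrictScalars ℝ ℂ _ hs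
  have hVC (s t : V) : s.1 + Complex.I • t.1 ∈ Submodule.span ℂ (Set.range a) :=
    add_mem (hRC (hVR s.2)) (Submodule.smul_mem _ _ (hRC (hVR t.2)))
  have hV : ∀ s ∈ V, Integrable (fun x => ‖s x‖ ^ 2) μ := by
    refine integrable_norm_sq_of_mem_span (fun s hs => hmeas s (hRC (hVR hs))) ?_
    rintro _ ⟨v, hv, rfl⟩
    exact hF v hv
  have : FiniteDimensional ℝ V :=
    FiniteDimensional.span_of_finite ℝ (F.finite_toSet.image a)
  obtain ⟨k₁, k₂, hk, hx⟩ := exists_reInner_eq V hV (fun s t => hmeas _ (hVC s t))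
    (fun s t => hconj _ (hVR s.2) _ (hVR t.2)) x r fun s t => hle _ (hVC s t)
  let Λ := AddSubgroup.closure (F : Set Γ)
  have hmem (l : Λ) : a l ∈ V := by
    obtain ⟨l, hl⟩ := l
    have : Λ ≤ V.toAddSubgroup.comap a :=
      (AddSubgroup.closure_le _).2 fun v hv => Submodule.subset_span ⟨v, hv, rfl⟩
    exact this hl
  let j : Λ →+ V := (a.comp Λ.subtype).codRestrict V hmem
  let g : F → Λ := fun v => ⟨v.1, AddSubgroup.subset_closure v.2⟩
  have hg : Submodule.span ℝ (Set.range fun i => j (g i)) = ⊤ := by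
    have hinj : Function.Injective (Submodule.map V.subtype) :=
      Submodule.map_injective_of_injective V.injective_subtype
    apply hinj
    rw [Submodule.map_span, Submodule.map_top, Submodule.range_subtype, ← Set.range_comp]
    refine congrArg (Submodule.span ℝ) ?_
    ext s
    constructor
    · rintro ⟨v, rfl⟩
      exact ⟨v.1, v.2, rfl⟩
    · rintro ⟨v, hv, rfl⟩
      exact ⟨⟨v, hv⟩, rfl⟩
  have hw (l : Λ) : l2Weight μ (a l) = formGaussian (reInner V hV) Real.pi (j l) :=
    l2Weight_eq V hV (j l)
  have hle0 : shiftedTheta (reInner V hV) j 0 ≤ ∑' u, l2Weight μ (a u) := by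
    simp only [shiftedTheta, add_zero, ← hw]
    exact ENNReal.tsum_comp_le_tsum_of_injective Subtype.val_injective fun u => l2Weight μ (a u)
  have h0 := ne_top_of_le_ne_top hS hle0
  have hsum (k : V) : 2 * Real.pi * ∑ v : F, reInner V hV (j (g v)) k ^ 2 *
      Real.exp (-(Real.pi * reInner V hV (j (g v)) (j (g v)))) ≤
      reInner V hV k k * (shiftedTheta (reInner V hV) j 0).toReal := by
    have h := sum_sq_mul_formGaussian_le j (reInner_comm V hV)
      (reInner_self_nonneg V hV) g hg h0
      (Finset.univ.map ⟨g, fun v w h => Subtype.ext (congrArg (fun l : Λ => l.1) h)⟩) k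
    rwa [Finset.sum_map] at h
  have hterm (v : F) : ENNReal.ofReal (‖a v.1 x‖ ^ 2) * l2Weight μ (a v.1) = ENNReal.ofReal
      (‖a v.1 x‖ ^ 2 * Real.exp (-(Real.pi * reInner V hV (j (g v)) (j (g v))))) := by
    rw [ENNReal.ofReal_mul (sq_nonneg _), show l2Weight μ (a v.1) = _ from hw (g v), formGaussian]
  refine le_trans ?_ (mul_le_mul_right hle0 _)
  rw [← Finset.sum_coe_sort F, Finset.sum_congr rfl fun v _ => hterm v,
    ← ENNReal.ofReal_sum_of_nonneg fun v _ => by positivity,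
    ← ENNReal.ofReal_mul (by positivity), ← ENNReal.ofReal_toReal h0,
    ← ENNReal.ofReal_coe_nnreal, ← ENNReal.ofReal_mul r.coe_nonneg]
  refine ENNReal.ofReal_le_ofReal ?_
  have hxj (v : F) : ‖a v.1 x‖ ^ 2 =
      reInner V hV (j (g v)) k₁ ^ 2 + reInner V hV (j (g v)) k₂ ^ 2 := hx (j (g v))
  simp only [hxj, add_mul, Finset.sum_add_distrib]
  have h1 := hsum k₁
  have h2 := hsum k₂
  have h3 := mul_le_mul_of_nonneg_right hk
    (ENNReal.toReal_nonneg (a := shiftedTheta (reInner V hV) j 0))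
  linarith

/-- The comparison of the theta invariant with the distortion for a group of functions. -/
theorem two_pi_mul_tsum_l2Weight_le
    (hmeas : ∀ s ∈ Submodule.span ℂ (Set.range a), Measurable fun x => ‖s x‖)
    (hconj : ∀ s ∈ Submodule.span ℝ (Set.range a), ∀ t ∈ Submodule.span ℝ (Set.range a),
      ∫⁻ x, ENNReal.ofReal (‖(s + Complex.I • t) x‖ ^ 2) ∂μ =
      ∫⁻ x, ENNReal.ofReal (‖(s - Complex.I • t) x‖ ^ 2) ∂μ) (x : X) (r : NNReal)
    (hle : ∀ s ∈ Submodule.span ℂ (Set.range a), ∫⁻ x, ENNReal.ofReal (‖s x‖ ^ 2) ∂μ ≠ ∞ →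
      ENNReal.ofReal (‖s x‖ ^ 2) ≤ r * ∫⁻ x, ENNReal.ofReal (‖s x‖ ^ 2) ∂μ) :
    ENNReal.ofReal (2 * Real.pi) * ∑' v, ENNReal.ofReal (‖a v x‖ ^ 2) *
      (l2Weight μ (a v) / ∑' u, l2Weight μ (a u)) ≤ r := by
  classical
  rcases eq_or_ne (∑' u, l2Weight μ (a u)) ∞ with hS | hS
  -- With an infinite denominator every quotient is 0.
  · simp [hS]
  have hS0 : ∑' u, l2Weight μ (a u) ≠ 0 := by
    intro h
    have h1 := ENNReal.tsum_eq_zero.1 h 0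
    simp [l2Weight] at h1
  simp only [div_eq_mul_inv _ (∑' u, l2Weight μ (a u))]
  simp only [ENNReal.tsum_mul_right, ← mul_assoc]
  rw [← div_eq_mul_inv, ENNReal.div_le_iff hS0 hS, ENNReal.tsum_eq_iSup_sum, ENNReal.mul_iSup]
  refine iSup_le fun F => ?_
  -- Elements of infinite norm have weight 0 and can be dropped from F.
  refine le_trans (le_of_eq ?_) (sum_norm_sq_mul_l2Weight_le a hmeas hconj x r hle hS
    (F.filter fun v => ∫⁻ x, ENNReal.ofReal (‖a v x‖ ^ 2) ∂μ ≠ ∞)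
    fun v hv => (Finset.mem_filter.1 hv).2)
  congr 1
  refine (Finset.sum_filter_of_ne fun v _ hv => ?_).symm
  intro htop
  exact hv (by rw [l2Weight_of_eq_top htop, mul_zero])

end SquareIntegrable

/-! ### From sections of the line bundle to functions. -/

section Sections

variable {𝒳 : Scheme.{0}} {ℒ : 𝒳.Modules}

theorem ComplexPoints.isOpen_pt_mem (U : 𝒳.Opens) : IsOpen {x : ComplexPoints 𝒳 | x.pt ∈ U} :=
  isOpen_generateFrom_of_mem ⟨U, 0, Set.univ, isOpen_univ, by ext x; simp⟩

theorem ComplexPoints.continuous_eval {U : 𝒳.Opens} (f : Γ(𝒳, U)) :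
    Continuous fun x : {x : ComplexPoints 𝒳 // x.pt ∈ U} => x.1.eval x.2 f := by
  refine continuous_def.2 fun W hW => ?_
  refine isOpen_induced_iff.2 ⟨_, isOpen_generateFrom_of_mem ⟨U, f, W, hW, rfl⟩, ?_⟩
  ext ⟨x, hx⟩
  exact ⟨fun ⟨_, h⟩ => h, fun h => ⟨hx, h⟩⟩

theorem valueAt_map {U V : 𝒳.Opens} (h : V ≤ U) (s : Γ(ℒ, U)) (x : ComplexPoints 𝒳)
    (hx : x.pt ∈ V) :
    valueAt ℒ (ℒ.presheaf.map (homOfLE h).op s) x hx = valueAt ℒ s x (h hx) := by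
  simp only [valueAt]
  rw [TopCat.Presheaf.germ_res_apply]

theorem tmul_germ_smul {U : 𝒳.Opens} (z : ℂ) (f : Γ(𝒳, U)) (e : Γ(ℒ, U)) (x : ComplexPoints 𝒳)
    (hx : x.pt ∈ U) :
    (z ⊗ₜ[↑(𝒳.presheaf.stalk x.pt)] (ℒ.presheaf.germ U x.pt hx (f • e)) : Fibre ℒ x) =
      (x.eval hx f * z) • valueAt ℒ e x hx := by
  rw [germ_smul, ← TensorProduct.smul_tmul, valueAt, TensorProduct.smul_tmul', smul_eq_mul,
    mul_one]
  rfl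

theorem exists_valueAt_eq {U : 𝒳.Opens} {e : Γ(ℒ, U)} (he : IsFrame ℒ U e) (v : Γ(ℒ, ⊤)) :
    ∃ f : Γ(𝒳, U), ∀ (x : ComplexPoints 𝒳) (hx : x.pt ∈ U),
      analytify ℒ v x = x.eval hx f • valueAt ℒ e x hx := by
  obtain ⟨f, hf⟩ := (he U le_rfl).2 (ℒ.presheaf.map (homOfLE le_top).op v)
  refine ⟨f, fun x hx => ?_⟩
  rw [analytify, ← valueAt_map (le_top : U ≤ ⊤) v x hx, ← hf]
  dsimp only
  rw [valueAt, tmul_germ_smul, mul_one, valueAt_map]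

theorem exists_eq_smul_valueAt {U : 𝒳.Opens} {e : Γ(ℒ, U)} (he : IsFrame ℒ U e)
    (x : ComplexPoints 𝒳) (hx : x.pt ∈ U) (v : Fibre ℒ x) : ∃ z : ℂ, v = z • valueAt ℒ e x hx := by
  induction v using TensorProduct.induction_on with
  | zero => exact ⟨0, (zero_smul _ _).symm⟩
  | add v w hv hw =>
    obtain ⟨z, rfl⟩ := hv
    obtain ⟨z', rfl⟩ := hw
    exact ⟨z + z', (add_smul _ _ _).symm⟩
  | tmul z g =>
    obtain ⟨V, hV, s, rfl⟩ := TopCat.Presheaf.exists_germ_eq ℒ.presheaf g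
    have hxW : x.pt ∈ V ⊓ U := ⟨hV, hx⟩
    obtain ⟨f, hf⟩ := (he (V ⊓ U) inf_le_right).2 (ℒ.presheaf.map (homOfLE inf_le_left).op s)
    refine ⟨x.eval hxW f * z, ?_⟩
    rw [← TopCat.Presheaf.germ_res_apply ℒ.presheaf (homOfLE (inf_le_left : V ⊓ U ≤ V)) x.pt hxW,
      ← hf]
    dsimp only
    rw [tmul_germ_smul, valueAt_map]

/-- Allowing e = 0 spares a proof that frames do not vanish in the fibres. -/
theorem exists_linearMap_norm_eq {E : Type*} [AddCommGroup E] [Module ℂ E] (N : Seminorm ℂ E)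
    (e : E) (he : ∀ v, ∃ z : ℂ, v = z • e) : ∃ ℓ : E →ₗ[ℂ] ℂ, ∀ v, ‖ℓ v‖ = N v := by
  rcases eq_or_ne e 0 with rfl | h0
  · refine ⟨0, fun v => ?_⟩
    obtain ⟨z, rfl⟩ := he v
    simp
  · let ε : ℂ ≃ₗ[ℂ] E := LinearEquiv.ofBijective (LinearMap.toSpanSingleton ℂ E e)
      ⟨smul_left_injective ℂ h0, fun v => (he v).imp fun _ h => h.symm⟩
    refine ⟨(N e : ℂ) • ε.symm.toLinearMap, fun v => ?_⟩
    obtain ⟨z, rfl⟩ := he v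
    have hz : ε.symm (z • e) = z := ε.symm_apply_apply z
    rw [LinearMap.smul_apply, LinearEquiv.coe_coe, hz, norm_smul, map_smul_eq_mul,
      Complex.norm_real, Real.norm_of_nonneg (apply_nonneg N e), mul_comm]

/-- Turns sections into complex functions with the same pointwise norm. The choice is made fibre by
fibre, with no regularity in x. -/
theorem exists_fibre_functional (hℒ : IsLineBundle ℒ) (φ : HermitianMetric ℒ)
    (x : ComplexPoints 𝒳) : ∃ ℓ : Fibre ℒ x →ₗ[ℂ] ℂ, ∀ v, ‖ℓ v‖ = φ.norm x v := by
  obtain ⟨U, hx, e, he⟩ := hℒ x.pt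
  exact exists_linearMap_norm_eq (φ.norm x) _ (exists_eq_smul_valueAt he x hx)

/-- Near every point, a complex linear combination of global sections of `ℒ` is a linear combination
of regular functions times a frame. -/
theorem exists_linearCombination_eq (hℒ : IsLineBundle ℒ) (c : Γ(ℒ, ⊤) →₀ ℂ)
    (x : ComplexPoints 𝒳) : ∃ (U : 𝒳.Opens) (_ : x.pt ∈ U) (e : Γ(ℒ, U)) (f : Γ(ℒ, ⊤) → Γ(𝒳, U)),
      IsFrame ℒ U e ∧ ∀ (y : ComplexPoints 𝒳) (hy : y.pt ∈ U),
        Finsupp.linearCombination ℂ (analytify ℒ) c y =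
          (∑ v ∈ c.support, c v * y.eval hy (f v)) • valueAt ℒ e y hy := by
  obtain ⟨U, hx, e, he⟩ := hℒ x.pt
  choose f hf using exists_valueAt_eq he
  refine ⟨U, hx, e, f, he, fun y hy => ?_⟩
  rw [Finsupp.linearCombination_apply, Finsupp.sum, Finset.sum_apply, Finset.sum_smul]
  refine Finset.sum_congr rfl fun v _ => ?_
  rw [Pi.smul_apply, hf v y hy, mul_smul]

theorem continuous_norm_linearCombination (hℒ : IsLineBundle ℒ) (φ : HermitianMetric ℒ)
    (c : Γ(ℒ, ⊤) →₀ ℂ) :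
    Continuous fun x => φ.norm x (Finsupp.linearCombination ℂ (analytify ℒ) c x) := by
  refine continuous_iff_continuousAt.2 fun x => ?_
  obtain ⟨U, hx, e, f, -, hf⟩ := exists_linearCombination_eq hℒ c x
  refine ContinuousOn.continuousAt (s := {y | y.pt ∈ U}) ?_
    ((ComplexPoints.isOpen_pt_mem U).mem_nhds hx)
  rw [continuousOn_iff_continuous_domRestrict]
  have h : Continuous fun y : {y : ComplexPoints 𝒳 // y.pt ∈ U} =>
      ‖∑ v ∈ c.support, c v * y.1.eval y.2 (f v)‖ * φ.norm y.1 (valueAt ℒ e y.1 y.2) :=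
    (continuous_finsetSum _ fun v _ =>
      continuous_const.mul (ComplexPoints.continuous_eval (f v))).norm.mul (φ.continuous U e)
  refine h.congr fun y => ?_
  rw [Set.domRestrict_apply, hf y.1 y.2, map_smul_eq_mul]

theorem isHolomorphicSection_linearCombination (hℒ : IsLineBundle ℒ) (c : Γ(ℒ, ⊤) →₀ ℂ) :
    IsHolomorphicSection ℒ (Finsupp.linearCombination ℂ (analytify ℒ) c) := by
  classical
  intro x
  obtain ⟨U, hx, e, f, he, hf⟩ := exists_linearCombination_eq hℒ c x
  have hU := (ComplexPoints.isOpen_pt_mem U).mem_nhds hx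
  refine ⟨U, hx, e, fun y => if hy : y.pt ∈ U then ∑ v ∈ c.support, c v * y.eval hy (f v) else 0,
    he, ?_, ?_⟩
  -- The power series is a linear form in the regular coefficient functions.
  · refine ⟨U, hx, c.support.card, fun i => f (c.support.equivFin.symm i),
      fun w => ∑ i, c (c.support.equivFin.symm i) * w i, ?_, ?_⟩
    · exact Finset.analyticAt_fun_sum _ fun i _ => analyticAt_const.mul
        ((ContinuousLinearMap.proj (R := ℂ) (φ := fun _ => ℂ) i).analyticAt _)
    · filter_upwards [hU] with y hy
      refine ⟨hy, ?_⟩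
      rw [dif_pos hy, ← Finset.sum_coe_sort]
      exact (c.support.equivFin.symm.sum_comp fun v => c v.1 * y.eval hy (f v.1)).symm
  · filter_upwards [hU] with y hy
    exact ⟨hy, by rw [hf y hy, dif_pos hy]⟩

theorem Theta_le_bergmanDistortion (hℒ : IsLineBundle ℒ) (φ : HermitianMetric ℒ)
    (μ : Measure (ComplexPoints 𝒳)) (hconj : ConjInvariant φ μ) (x : ComplexPoints 𝒳) :
    Theta φ μ 1 x ≤ bergmanDistortion φ μ x := by
  rcases eq_or_ne (bergmanDistortion φ μ x) ∞ with htop | htop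
  · rw [htop]
    exact le_top
  obtain ⟨r, hr⟩ : ∃ r : NNReal, bergmanDistortion φ μ x = r :=
    ⟨_, (ENNReal.coe_toNNReal htop).symm⟩
  choose ℓ hℓ using exists_fibre_functional hℒ φ
  let T : (∀ x : ComplexPoints 𝒳, Fibre ℒ x) →ₗ[ℂ] (ComplexPoints 𝒳 → ℂ) :=
    LinearMap.pi fun x => ℓ x ∘ₗ LinearMap.proj x
  have hT (s : ∀ x : ComplexPoints 𝒳, Fibre ℒ x) (y : ComplexPoints 𝒳) :
      ‖T s y‖ = φ.norm y (s y) := hℓ y (s y)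
  have hL (s : ∀ x : ComplexPoints 𝒳, Fibre ℒ x) :
      ∫⁻ y, ENNReal.ofReal (‖T s y‖ ^ 2) ∂μ = l2NormSq φ μ s := by
    simp only [hT, l2NormSq]
  let an : Γ(ℒ, ⊤) →+ ∀ x : ComplexPoints 𝒳, Fibre ℒ x :=
    { toFun := analytify ℒ
      map_zero' := by
        funext y
        simp only [analytify, valueAt, map_zero, TensorProduct.tmul_zero, Pi.zero_apply]
      map_add' := fun v w => by
        funext y
        simp only [analytify, valueAt, map_add, TensorProduct.tmul_add, Pi.add_apply] }
  let a : Γ(ℒ, ⊤) →+ (ComplexPoints 𝒳 → ℂ) := T.toAddMonoidHom.comp an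
  have hspan {s : ComplexPoints 𝒳 → ℂ} (hs : s ∈ Submodule.span ℂ (Set.range a)) :
      ∃ c, T (Finsupp.linearCombination ℂ (analytify ℒ) c) = s := by
    obtain ⟨c, rfl⟩ := Finsupp.mem_span_range_iff_exists_finsupp.1 hs
    exact ⟨c, by rw [Finsupp.linearCombination_apply, map_finsuppSum]; simp only [map_smul]; rfl⟩
  have hspanR {s : ComplexPoints 𝒳 → ℂ} (hs : s ∈ Submodule.span ℝ (Set.range a)) :
      ∃ c : Γ(ℒ, ⊤) →₀ ℂ, (∀ v, starRingEnd ℂ (c v) = c v) ∧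
        T (Finsupp.linearCombination ℂ (analytify ℒ) c) = s := by
    obtain ⟨c, rfl⟩ := Finsupp.mem_span_range_iff_exists_finsupp.1 hs
    refine ⟨c.mapRange Complex.ofReal Complex.ofReal_zero, fun v => by simp, ?_⟩
    rw [Finsupp.linearCombination_apply, map_finsuppSum, Finsupp.sum_mapRange_index (by simp)]
    exact Finsupp.sum_congr fun v _ =>
      (T.map_smul (c v : ℂ) (analytify ℒ v)).trans (Complex.coe_smul _ _)
  have hw (v : Γ(ℒ, ⊤)) : gaussWeight φ μ 1 v = l2Weight μ (a v) := by
    rw [gaussWeight, ← hL]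
    rfl
  have hx (v : Γ(ℒ, ⊤)) : φ.norm x (analytify ℒ v x) = ‖a v x‖ := (hT _ _).symm
  simp only [Theta, hw, hx]
  rw [hr]
  refine two_pi_mul_tsum_l2Weight_le a (fun s hs => ?_) (fun s hs t ht => ?_) x r
    fun s hs hfin => ?_
  · obtain ⟨c, rfl⟩ := hspan hs
    simp only [hT]
    exact (continuous_norm_linearCombination hℒ φ c).measurable
  · obtain ⟨c, hc, rfl⟩ := hspanR hs
    obtain ⟨d, hd, rfl⟩ := hspanR ht
    rw [← map_smul, ← map_smul, ← map_add, ← map_sub, ← map_add, ← map_sub, hL, hL]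
    -- As c and d have real coefficients, conjugation turns c + id into c - id.
    have h := hconj (c + Complex.I • d)
    have h1 : ((c + Complex.I • d).sum fun v z => starRingEnd ℂ z • analytify ℒ v) =
        Finsupp.linearCombination ℂ (analytify ℒ) (c - Complex.I • d) := by
      have h2 : c - Complex.I • d = (c + Complex.I • d).mapRange (starRingEnd ℂ) (map_zero _) := by
        ext v
        simp [hc, hd, sub_eq_add_neg]
      rw [h2, Finsupp.linearCombination_apply, Finsupp.sum_mapRange_index (by simp)]
    rwa [h1] at h
  · obtain ⟨c, rfl⟩ := hspan hs
    rw [hL] at hfin ⊢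
    rw [hT]
    set σ := Finsupp.linearCombination ℂ (analytify ℒ) c
    rcases eq_or_ne σ 0 with h0 | h0
    · simp [h0]
    -- Finiteness of ρ(x) covers the case ‖σ‖ = 0, where a/0 = ∞ for a > 0 would make the supremum
    -- infinite.
    rw [← hr, ← ENNReal.div_le_iff_le_mul (.inr htop) (.inl hfin)]
    exact le_iSup_of_le σ (le_iSup_of_le (isHolomorphicSection_linearCombination hℒ c)
      (le_iSup_of_le h0 le_rfl))

end Sections
end

end ArithTheta

theorem mainTheorem6 {𝒳 : Scheme.{0}} (π : 𝒳 ⟶ Spec (CommRingCat.of ℤ))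
    (h𝒳 : ArithTheta.IsArithmeticVariety π) (ℒ : 𝒳.Modules) (hℒ : ArithTheta.IsLineBundle ℒ)
    (φ : ArithTheta.HermitianMetric ℒ) (μ : Measure (ArithTheta.ComplexPoints 𝒳))
    [IsProbabilityMeasure μ] (hconj : ArithTheta.ConjInvariant φ μ) :
    ∀ x : ArithTheta.ComplexPoints 𝒳,
      ArithTheta.Theta φ μ 1 x ≤ ArithTheta.bergmanDistortion φ μ x := by
  exact fun x => ArithTheta.Theta_le_bergmanDistortion hℒ φ μ hconj x
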